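/- Let $K$ be a global field, that is, an algebraic number field or an algebraic function field in one variable over a finite field. Let $S$ be a finite nonempty set of primes (places) of $K$ which contains all archimedean primes if $K$ is a number field, and let $A=\{a\in K : \mathrm{ord}_P(a)\ge 0 \text{ for all nonarchimedean primes } P\notin S\}$ be the ring of $S$-integers of $K$. Let $k,m\ge 1$ be integers. For a nonzero prime ideal $P$ of $A$, call $a\in A$ a $k$th power residue modulo $P$ if $a\equiv x^k \pmod P$ for some $x\in A$. A sequence $a_1,\dots,a_m$ in $A$ is a chain of $k$th power residues modulo $P$ if the $m(m+1)/2$ sums $\sum_{l=i}^{j}a_l$ $(1\le i\le j\le m)$ are $k$th power residues modulo $P$ and are pairwise distinct modulo $P$. It is a permutation chain of $k$th power residues modulo $P$ if $a_{\sigma(1)},\dots,a_{\sigma(m)}$ is a chain of $k$th power residues modulo $P$ for every permutation $\sigma\in S_m$. **Theorem.** Let $r_1,\dots,r_m\in A$ be such that for every permutation $\sigma\in S_m$ the $m(m+1)/2$ sums $\sum_{l=i}^{j}r_{\sigma(l)}$ $(1\le i\le j\le m)$ are pairwise distinct. Then there are infinitely many nonzero prime ideals $P$ of $A$ such that $r_1,\dots,r_m$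 is a permutation chain of $k$th power residues modulo $P$ and such that, moreover, every sum $\sum_{l=i}^{j}r_{\sigma(l)}$ ($\sigma\in S_m$, $1\le i\le j\le m$) that is nonzero in $A$ is nonzero modulo $P$. -/

import Mathlib

/-- `K` is an algebraic function field (in one variable) over a finite field: there are a finite
subfield `F` of `K` and an element `t` of `K`, transcendental over `F`, such that `K` is a finite
extension of `F(t)`. -/
def IsGlobalFunctionField (K : Type*) [Field K] : Prop :=
  ∃ (F : Subfield K) (t : K), Finite F ∧ Transcendental F t ∧
    FiniteDimensional (IntermediateField.adjoin F {t}) K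

/-- A global field: an algebraic number field, or an algebraic function field with a finite
constant field. -/
def IsGlobalField (K : Type*) [Field K] : Prop :=
  NumberField K ∨ IsGlobalFunctionField K

/-- A nonarchimedean prime of `K`, given by its valuation ring `{a | 0 ≤ ord a}`: a discrete
valuation ring contained in `K` with fraction field `K`. -/
abbrev FinitePrime (K : Type*) [Field K] : Type _ :=
  {V : ValuationSubring K // IsDiscreteValuationRing V}

/-- The primes of `K`: the nonarchimedean ones and the archimedean ones (of which a field of
positive characteristic has none). -/
abbrev GlobalPrime (K : Type*) [Field K] : Type _ :=
  FinitePrime K ⊕ NumberField.InfinitePlace K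

/-- The ring `{a ∈ K | ord_P a ≥ 0 for all P ∉ S}`, for a set `S` of primes of `K`
that contains the archimedean ones. -/
def sIntegers {K : Type*} [Field K] (S : Set (GlobalPrime K)) : Subring K :=
  ⨅ (V : FinitePrime K) (_ : Sum.inl V ∉ S), V.1.toSubring

/-- The sum `r_i + ⋯ + r_j` of consecutive terms of a finite sequence. -/
def consecutiveSum {A : Type*} [CommRing A] {m : ℕ} (r : Fin m → A) (i j : Fin m) : A :=
  ∑ l ∈ Finset.Icc i j, r l

/-- `a` is congruent to a `k`th power modulo `P`. -/
def IsPowerResidue {A : Type*} [CommRing A] (k : ℕ) (P : Ideal A) (a : A) : Prop :=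
  ∃ x : A, Ideal.Quotient.mk P a = Ideal.Quotient.mk P (x ^ k)

/-- `r` is a chain of `k`th power residues modulo `P`: the sums `r_i + ⋯ + r_j` with `i ≤ j` are
`k`th power residues modulo `P`, and they are distinct modulo `P` for distinct pairs `(i, j)`. -/
def IsResidueChain {A : Type*} [CommRing A] {m : ℕ} (k : ℕ) (P : Ideal A) (r : Fin m → A) :
    Prop :=
  (∀ i j : Fin m, i ≤ j → IsPowerResidue k P (consecutiveSum r i j)) ∧
    Set.InjOn (fun p : Fin m × Fin m => Ideal.Quotient.mk P (consecutiveSum r p.1 p.2))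
      {p | p.1 ≤ p.2}

/-- `r` is a permutation chain of `k`th power residues modulo `P`: every rearrangement of `r` is a
chain of `k`th power residues modulo `P`. -/
def IsPermutationChain {A : Type*} [CommRing A] {m : ℕ} (k : ℕ) (P : Ideal A) (r : Fin m → A) :
    Prop :=
  ∀ σ : Equiv.Perm (Fin m), IsResidueChain k P (fun l => r (σ l))

/-! Only finitely many elements of A are involved: the sums must become kth powers modulo P, while
the nonzero sums and the nonzero differences of sums must stay outside P. If the good primes were
finitely many, one could also avoid a nonzero element of each of them. So it is enough to find one
nonzero prime modulo which given elements are kth powers and which avoids given nonzero elements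
(`exists_isPrime_isPowerResidue_notMem`).

No density theorem is needed. Let R be ℤ or F[s], contained in A, with K finite separable over the
fraction field of R. Write k = n * q ^ e with q the exponential characteristic and n nonzero in K,
and adjoin nth roots of the sums to get a finite separable extension L. If θ is a primitive element
of L integral over R, Euclid's argument gives a maximal ideal M of R, avoiding a given element,
modulo which the minimal polynomial of θ has a root. Hence a localization of R[θ], large enough to
contain A and the roots, maps to R/M (`exists_isMaximal_subalgebra_algHom`). Take P to be the kernel
on A: the nth roots have images in R/M, and q^e-th roots exist there because Frobenius is surjective
on a finite field.

For function fields the difficulty is to find a separating element s inside A. A pigeonhole argument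
replaces Riemann–Roch and gives a nonconstant function with no pole outside one place of S
(`exists_transcendental_forall_mem_of_ne`). Hence K is the fraction field of A, and a transcendental
element of A with minimal inseparable degree is separating. -/

/-! ### Discrete valuation rings of K, Dedekind domains and S-integers. -/

section DiscreteValuationSubrings

open IsDedekindDomain

variable {K : Type*} [Field K]

theorem ValuationSubring.ne_top_of_isDiscreteValuationRing (V : ValuationSubring K)
    [IsDiscreteValuationRing V] : V ≠ ⊤ := by
  rintro rfl
  refine IsDiscreteValuationRing.not_isField (⊤ : ValuationSubring K) ?_
  exact MulEquiv.isField (Field.toIsField K) (Subring.topEquiv (R := K)).toMulEquiv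

/-- Each factor c raises the order by at least one, so n₀ can be the order of a denominator of a. -/
theorem ValuationSubring.exists_pow_mul_mem (V : ValuationSubring K) [IsDiscreteValuationRing V]
    {c : K} (hc : V.valuation c < 1) (a : K) : ∃ n₀, ∀ n ≥ n₀, c ^ n * a ∈ V := by
  have hcV : c ∈ V := (V.valuation_le_one_iff c).1 hc.le
  obtain ⟨⟨x, hx⟩, ⟨y, hy⟩, hy0, rfl⟩ := IsFractionRing.div_surjective (A := V) a
  have hy0' : (⟨y, hy⟩ : V) ≠ 0 := nonZeroDivisors.ne_zero hy0
  obtain ⟨ϖ, hϖ⟩ := IsDiscreteValuationRing.exists_irreducible V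
  obtain ⟨n₀, u, hu⟩ := IsDiscreteValuationRing.eq_unit_mul_pow_irreducible hy0' hϖ
  have hcm : (⟨c, hcV⟩ : V) ∈ IsLocalRing.maximalIdeal V := (V.valuation_lt_one_iff _).2 hc
  rw [hϖ.maximalIdeal_eq, Ideal.mem_span_singleton] at hcm
  refine ⟨n₀, fun n hn ↦ ?_⟩
  have hdvd : (⟨y, hy⟩ : V) ∣ ⟨c, hcV⟩ ^ n := by
    rw [hu, mul_comm]
    exact (Units.mul_right_dvd).2 ((pow_dvd_pow _ hn).trans (pow_dvd_pow_of_dvd hcm n))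
  obtain ⟨z, hz⟩ := hdvd
  have hz' : c ^ n = y * (z : K) := congrArg Subtype.val hz
  have hy1 : y ≠ 0 := fun h ↦ hy0' (Subtype.ext h)
  have : c ^ n * (x / y) = z * x := by rw [hz']; field_simp
  change c ^ n * (x / y) ∈ V
  rw [this]
  exact V.mul_mem _ _ z.2 hx

theorem ValuationSubring.mem_of_isIntegral {R : Type*} [CommRing R] [Algebra R K]
    (V : ValuationSubring K) (hR : ∀ x : R, algebraMap R K x ∈ V) {x : K} (hx : IsIntegral R x) :
    x ∈ V := by
  have : (algebraMap R K).range ≤ V.toSubring := by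
    rintro _ ⟨y, rfl⟩
    exact hR y
  obtain ⟨f, hf, hfx⟩ := hx
  have hint : V.valuation.Integers V := by
    have := Valuation.valuationSubring.integers V.valuation
    rwa [V.valuationSubring_valuation] at this
  refine (V.valuation_le_one_iff x).1 (hint.isIntegral_iff_v_le_one.1 ?_)
  refine ⟨f.map ((algebraMap R K).codRestrict V.toSubring hR), hf.map _, ?_⟩
  rw [Polynomial.eval₂_map]
  exact hfx

variable {O : Type*} [CommRing O] [IsDedekindDomain O] [Algebra O K] [IsFractionRing O K]

namespace IsDedekindDomain.HeightOneSpectrum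

instance isDiscreteValuationRing_valuationSubringAtPrime (v : HeightOneSpectrum O) :
    IsDiscreteValuationRing (valuationSubringAtPrime K v) :=
  IsLocalization.AtPrime.isDiscreteValuationRing_of_dedekind_domain O v.ne_bot _

theorem mem_valuationSubringAtPrime_iff (v : HeightOneSpectrum O) (x : K) :
    x ∈ valuationSubringAtPrime K v ↔ v.valuation K x ≤ 1 := by
  rw [valuationSubringAtPrime_eq_valuationSubring, Valuation.mem_valuationSubring_iff]

theorem algebraMap_mem_valuationSubringAtPrime (v : HeightOneSpectrum O) (x : O) :
    algebraMap O K x ∈ valuationSubringAtPrime K v :=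
  (v.mem_valuationSubringAtPrime_iff _).2 (v.valuation_le_one x)

/-- A proper valuation subring containing a Dedekind domain with the same fraction field is
its localization at the center. -/
theorem exists_eq_valuationSubringAtPrime (V : ValuationSubring K) (hV : V ≠ ⊤)
    (hO : ∀ x : O, algebraMap O K x ∈ V) :
    ∃ v : HeightOneSpectrum O, V = valuationSubringAtPrime K v ∧
      ∀ x : O, x ∈ v.asIdeal ↔ V.valuation (algebraMap O K x) < 1 := by
  let φ : O →+* V := (algebraMap O K).codRestrict V.toSubring hO
  let p : Ideal O := (IsLocalRing.maximalIdeal V).comap φ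
  have hp (x : O) : x ∈ p ↔ V.valuation (algebraMap O K x) < 1 := by
    rw [Ideal.mem_comap, V.valuation_lt_one_iff]; rfl
  have hunit (x : O) (hx : x ∉ p) : (algebraMap O K x)⁻¹ ∈ V := by
    rw [hp, not_lt] at hx
    rw [← V.valuation_le_one_iff, map_inv₀]
    exact inv_le_one_of_one_le₀ hx
  -- If the center were zero, V would contain the inverses of all nonzero elements of O, hence all
  -- of K.
  have hp0 : p ≠ ⊥ := by
    intro h
    apply hV
    rw [eq_top_iff]
    intro z _
    obtain ⟨x, y, hy, rfl⟩ := IsFractionRing.div_surjective (A := O) z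
    rw [div_eq_mul_inv]
    refine V.mul_mem _ _ (hO x) (hunit y ?_)
    rw [h, Ideal.mem_bot]
    exact nonZeroDivisors.ne_zero hy
  let v : HeightOneSpectrum O := ⟨p, Ideal.IsPrime.comap φ, hp0⟩
  refine ⟨v, Eq.symm (ValuationSubring.eq_of_le_of_ne_top _ ?_ hV), hp⟩
  rintro _ ⟨x, y, hy, rfl⟩
  exact V.mul_mem _ _ (hO x) (hunit y hy)

end IsDedekindDomain.HeightOneSpectrum

open HeightOneSpectrum

theorem IsDedekindDomain.mem_range_algebraMap_of_forall_isDiscreteValuationRing {x : K}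
    (hx : ∀ V : ValuationSubring K, IsDiscreteValuationRing V →
      (∀ y : O, algebraMap O K y ∈ V) → x ∈ V) : x ∈ (algebraMap O K).range :=
  mem_integers_of_valuation_le_one K x fun v ↦ (v.mem_valuationSubringAtPrime_iff x).1
    (hx _ inferInstance v.algebraMap_mem_valuationSubringAtPrime)

/-- There is an element whose only pole over a Dedekind domain is a given one. -/
theorem IsDedekindDomain.exists_notMem_forall_mem_of_ne (V : ValuationSubring K)
    [IsDiscreteValuationRing V] (hV : ∀ x : O, algebraMap O K x ∈ V) :
    ∃ b ∉ V, ∀ W : ValuationSubring K, IsDiscreteValuationRing W →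
      (∀ x : O, algebraMap O K x ∈ W) → W ≠ V → b ∈ W := by
  obtain ⟨v, hv, hvmem⟩ := exists_eq_valuationSubringAtPrime V
    V.ne_top_of_isDiscreteValuationRing hV
  -- Take b in the inverse of the prime of V but not in O. At another prime w, an element c of v
  -- outside w clears the denominator and is a unit. At V itself b must have a pole, since otherwise
  -- it would lie in O.
  obtain ⟨b, hb, hb1⟩ := FractionalIdeal.exists_notMem_one_of_ne_bot (K := K) v.ne_bot
    v.isPrime.ne_top
  have hother : ∀ W : ValuationSubring K, IsDiscreteValuationRing W →
      (∀ x : O, algebraMap O K x ∈ W) → W ≠ V → b ∈ W := by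
    intro W _ hW hWV
    obtain ⟨w, hw, hwmem⟩ := exists_eq_valuationSubringAtPrime W
      W.ne_top_of_isDiscreteValuationRing hW
    have hne : ¬ v.asIdeal ≤ w.asIdeal := fun hle ↦ hWV <| by
      have : v = w := HeightOneSpectrum.ext (v.isMaximal.eq_of_le w.isPrime.ne_top hle)
      rw [hw, hv, this]
    obtain ⟨c, hcv, hcw⟩ := SetLike.not_le_iff_exists.1 hne
    have hmul : b * algebraMap O K c ∈ (1 : FractionalIdeal (nonZeroDivisors O) K) :=
      (FractionalIdeal.mem_inv_iff (FractionalIdeal.coeIdeal_ne_zero.2 v.ne_bot)).1 hb _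
        ((FractionalIdeal.mem_coeIdeal _).2 ⟨c, hcv, rfl⟩)
    obtain ⟨d, hd⟩ := (FractionalIdeal.mem_one_iff _).1 hmul
    have hc0 : algebraMap O K c ≠ 0 := fun h ↦ hcw <| by
      rw [(IsFractionRing.to_map_eq_zero_iff (R := O)).1 h]; exact w.asIdeal.zero_mem
    have : b = algebraMap O K d * (algebraMap O K c)⁻¹ := by
      rw [hd, mul_assoc, mul_inv_cancel₀ hc0, mul_one]
    rw [this]
    refine W.mul_mem _ _ (hW d) ?_
    rw [hwmem, not_lt] at hcw
    rw [← W.valuation_le_one_iff, map_inv₀]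
    exact inv_le_one_of_one_le₀ hcw
  refine ⟨b, fun hbV ↦ hb1 ?_, hother⟩
  obtain ⟨y, hy⟩ := mem_range_algebraMap_of_forall_isDiscreteValuationRing (O := O)
    (x := b) fun W hW hOW ↦ by
      by_cases h : W = V
      · rwa [h]
      · exact hother W hW hOW h
  exact (FractionalIdeal.mem_one_iff _).2 ⟨y, hy⟩

variable (R G : Type*) [CommRing R] [IsDedekindDomain R] [Field G] [Algebra R G] [IsFractionRing R G]
  [Algebra R K] [Algebra G K] [IsScalarTower R G K] [FiniteDimensional G K]
  [Algebra.IsSeparable G K]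

include G in
-- The center of V on the integral closure of R is a nonzero prime, and in an integral extension of
-- domains it contracts to a nonzero prime of R.
theorem ValuationSubring.exists_ne_zero_valuation_lt_one (V : ValuationSubring K)
    [IsDiscreteValuationRing V] (hR : ∀ x : R, algebraMap R K x ∈ V) :
    ∃ r : R, r ≠ 0 ∧ V.valuation (algebraMap R K r) < 1 := by
  have := integralClosure.isDedekindDomain R G K
  have : IsFractionRing (integralClosure R K) K :=
    integralClosure.isFractionRing_of_finite_extension G K
  obtain ⟨v, -, hv⟩ := exists_eq_valuationSubringAtPrime (O := integralClosure R K) V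
    V.ne_top_of_isDiscreteValuationRing fun x ↦ V.mem_of_isIntegral hR x.2
  have hne : v.asIdeal.comap (algebraMap R (integralClosure R K)) ≠ ⊥ :=
    Ideal.IsIntegral.comap_ne_bot R v.ne_bot
  obtain ⟨r, hr, hr0⟩ := Submodule.exists_mem_ne_zero_of_ne_bot hne
  refine ⟨r, hr0, ?_⟩
  have := (hv _).1 (Ideal.mem_comap.1 hr)
  rwa [← IsScalarTower.algebraMap_apply] at this

omit [FiniteDimensional G K] [Algebra.IsSeparable G K] in
theorem mem_sIntegers_iff {S : Set (GlobalPrime K)} {x : K} :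
    x ∈ sIntegers S ↔ ∀ V : FinitePrime K, Sum.inl V ∉ S → x ∈ V.1 := by
  simp [sIntegers, Subring.mem_iInf]

include G in
-- This bounds A from above: inverting the single element N in the integral closure of R reaches
-- every S-integer. N vanishes at each place of S that contains R, so its powers cancel the poles
-- there; at the other places containing R an S-integer has no pole.
theorem exists_ne_zero_forall_mem_sIntegers_isIntegral {S : Set (GlobalPrime K)} (hS : S.Finite) :
    ∃ N : R, N ≠ 0 ∧ ∀ a ∈ sIntegers S, ∃ n : ℕ, IsIntegral R (algebraMap R K N ^ n * a) := by
  classical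
  have hfin : {V : FinitePrime K | Sum.inl V ∈ S}.Finite :=
    hS.preimage (Sum.inl_injective.injOn)
  have hex (V : FinitePrime K) : ∃ r : R, r ≠ 0 ∧
      ((∀ x : R, algebraMap R K x ∈ V.1) → V.1.valuation (algebraMap R K r) < 1) := by
    by_cases h : ∀ x : R, algebraMap R K x ∈ V.1
    · have := V.2
      obtain ⟨r, h0, h1⟩ := V.1.exists_ne_zero_valuation_lt_one R G h
      exact ⟨r, h0, fun _ ↦ h1⟩
    · exact ⟨1, one_ne_zero, fun h' ↦ absurd h' h⟩
  choose r hr0 hr using hex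
  refine ⟨∏ V ∈ hfin.toFinset, r V, Finset.prod_ne_zero_iff.2 fun V _ ↦ hr0 V, fun a ha ↦ ?_⟩
  set N := ∏ V ∈ hfin.toFinset, r V with hN
  have hval (V : FinitePrime K) (hV : Sum.inl V ∈ S) (hRV : ∀ x : R, algebraMap R K x ∈ V.1) :
      ∃ n₀, ∀ n ≥ n₀, algebraMap R K N ^ n * a ∈ V.1 := by
    have := V.2
    refine V.1.exists_pow_mul_mem ?_ a
    rw [hN, ← Finset.mul_prod_erase _ _ (hfin.mem_toFinset.2 hV), map_mul, map_mul]
    exact mul_lt_one_of_lt_of_le (hr V hRV) ((V.1.valuation_le_one_iff _).2 (hRV _))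
  have hex' (V : FinitePrime K) : ∃ n₀, Sum.inl V ∈ S → (∀ x : R, algebraMap R K x ∈ V.1) →
      ∀ n ≥ n₀, algebraMap R K N ^ n * a ∈ V.1 := by
    by_cases h : Sum.inl V ∈ S ∧ ∀ x : R, algebraMap R K x ∈ V.1
    · obtain ⟨n₀, hn₀⟩ := hval V h.1 h.2
      exact ⟨n₀, fun _ _ ↦ hn₀⟩
    · exact ⟨0, fun h1 h2 ↦ absurd ⟨h1, h2⟩ h⟩
  choose n₀ hn₀ using hex'
  refine ⟨hfin.toFinset.sup n₀, ?_⟩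
  have := integralClosure.isDedekindDomain R G K
  have : IsFractionRing (integralClosure R K) K :=
    integralClosure.isFractionRing_of_finite_extension G K
  obtain ⟨y, hy⟩ := mem_range_algebraMap_of_forall_isDiscreteValuationRing
    (O := integralClosure R K) (x := algebraMap R K N ^ hfin.toFinset.sup n₀ * a)
    fun V hV hO ↦ by
      have hRV (x : R) : algebraMap R K x ∈ V := by
        simpa only [← IsScalarTower.algebraMap_apply] using hO (algebraMap R _ x)
      by_cases h : Sum.inl (⟨V, hV⟩ : FinitePrime K) ∈ S
      · exact hn₀ ⟨V, hV⟩ h hRV _ (Finset.le_sup (f := n₀) (hfin.mem_toFinset.2 h))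
      · exact V.mul_mem _ _ (pow_mem (hRV _) _) (mem_sIntegers_iff.1 ha ⟨V, hV⟩ h)
  rw [← hy]
  exact y.2

end DiscreteValuationSubrings

/-! ### Roots of polynomials modulo maximal ideals of the base ring. -/

section ResidueFields

open Polynomial

/-- Euclid's argument: the values of a nonconstant polynomial over an infinite domain with finitely
many units have infinitely many prime divisors. -/
theorem Polynomial.exists_isMaximal_eval_mem_notMem {R : Type*} [CommRing R] [IsDomain R]
    [Infinite R] [Finite Rˣ] {f : R[X]} (hf : f.natDegree ≠ 0) {d : R} (hd : d ≠ 0) :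
    ∃ (M : Ideal R) (a : R), M.IsMaximal ∧ f.eval a ∈ M ∧ d ∉ M := by
  have hf0 : f ≠ 0 := fun h ↦ hf (by rw [h, natDegree_zero])
  obtain ⟨a₀, ha₀⟩ : ∃ a, f.eval a ≠ 0 := by
    by_contra! h
    exact hf0 (Polynomial.funext fun r ↦ by rw [h, eval_zero])
  set c := f.eval a₀ with hc
  -- Moving a₀ by multiples of c * d keeps the value divisible by c, with cofactor congruent to 1
  -- modulo d. A maximal ideal containing the cofactor then avoids d. If all cofactors were units,
  -- one of the finitely many units would occur infinitely often and f would be constant.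
  have hdvd (t : R) : ∃ w, f.eval (a₀ + c * d * t) = c * (1 + d * w) := by
    obtain ⟨w, hw⟩ := sub_dvd_eval_sub (a₀ + c * d * t) a₀ f
    refine ⟨t * w, ?_⟩
    rw [sub_eq_iff_eq_add] at hw
    rw [hw, ← hc]
    ring
  choose w hw using hdvd
  obtain ⟨t, ht⟩ : ∃ t, ¬ IsUnit (1 + d * w t) := by
    by_contra! h
    obtain ⟨u, hu⟩ := Finite.exists_infinite_fiber fun t ↦ (h t).unit
    have hinj : Function.Injective fun t : R ↦ a₀ + c * d * t := fun s t hst ↦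
      mul_left_cancel₀ (mul_ne_zero ha₀ hd) (add_left_cancel hst)
    have : f - C (c * u) = 0 := by
      refine eq_zero_of_infinite_isRoot _ (((Set.infinite_coe_iff.1 hu).image hinj.injOn).mono ?_)
      rintro _ ⟨t, ht, rfl⟩
      have ht' : 1 + d * w t = u := congrArg Units.val ht
      simp [hw, ht']
    rw [sub_eq_zero] at this
    exact hf (by rw [this, natDegree_C])
  obtain ⟨M, hM, hmem⟩ := exists_max_ideal_of_mem_nonunits ht
  refine ⟨M, _, hM, hw t ▸ M.mul_mem_left c hmem, fun hdM ↦ ?_⟩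
  refine M.ne_top_iff_one.1 hM.ne_top ?_
  simpa using M.sub_mem hmem (M.mul_mem_right (w t) hdM)

/-- Finitely many elements of a finite separable extension of the fraction field of `R` lie in an
`R`-subalgebra that has a quotient equal to a residue field of `R`. -/
theorem exists_isMaximal_subalgebra_algHom {R G L : Type*} [CommRing R] [IsDomain R]
    [IsIntegrallyClosed R] [Infinite R] [Finite Rˣ] [Field G] [Algebra R G] [IsFractionRing R G]
    [Field L] [Algebra R L] [Algebra G L] [IsScalarTower R G L] [FiniteDimensional G L]
    [Algebra.IsSeparable G L] (Y : Finset L) {d : R} (hd : d ≠ 0) :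
    ∃ (M : Ideal R) (B : Subalgebra R L), M.IsMaximal ∧ d ∉ M ∧ (Y : Set L) ⊆ B ∧
      Nonempty (B →ₐ[R] R ⧸ M) := by
  classical
  have hRL : Function.Injective (algebraMap R L) := by
    rw [IsScalarTower.algebraMap_eq R G L]
    exact (algebraMap G L).injective.comp (IsFractionRing.injective R G)
  have : FaithfulSMul R L := (faithfulSMul_iff_algebraMap_injective R L).2 hRL
  obtain ⟨θ, hθ, hint⟩ : ∃ θ : L, Algebra.adjoin G {θ} = ⊤ ∧ IsIntegral R θ := by
    obtain ⟨α, hα⟩ := Field.exists_primitive_element G L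
    obtain ⟨y, hy, hyα⟩ := exists_integral_multiples R G ({α} : Finset L)
    refine ⟨y • α, ?_, hyα α (by simp)⟩
    have hy' : algebraMap R G y ≠ 0 := by
      simpa using hy
    have h1 : IntermediateField.adjoin G {α} ≤ IntermediateField.adjoin G {y • α} := by
      rw [IntermediateField.adjoin_simple_le_iff]
      have : α = (algebraMap R G y)⁻¹ • (y • α) := by
        rw [← algebraMap_smul G y α, smul_smul, inv_mul_cancel₀ hy', one_smul]
      have hmem := (IntermediateField.adjoin G {y • α}).smul_mem (x := (algebraMap R G y)⁻¹)
        (IntermediateField.mem_adjoin_simple_self G _)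
      rwa [← this] at hmem
    rw [hα, top_le_iff] at h1
    rw [← IntermediateField.adjoin_simple_toSubalgebra_of_isAlgebraic
      (Algebra.IsAlgebraic.isAlgebraic (R := G) (y • α)), h1, IntermediateField.top_toSubalgebra]
  let C := Algebra.adjoin R {θ}
  have hmul (y : L) : ∃ r : R, r ≠ 0 ∧ algebraMap R L r * y ∈ C := by
    have hy : y ∈ Algebra.adjoin G {θ} := hθ ▸ Algebra.mem_top
    rw [Algebra.adjoin_singleton_eq_range_aeval] at hy
    obtain ⟨p, rfl⟩ := hy
    obtain ⟨b, hb, hbp⟩ := IsLocalization.integerNormalization_spec (nonZeroDivisors R) p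
    refine ⟨b, nonZeroDivisors.ne_zero hb, ?_⟩
    have : algebraMap R L b * aeval θ p =
        aeval θ (IsLocalization.integerNormalization (nonZeroDivisors R) p) := by
      rw [← aeval_map_algebraMap (R := R) G, hbp, ← algebraMap_smul G b p, map_smul,
        Algebra.smul_def, ← IsScalarTower.algebraMap_apply]
    exact this ▸ aeval_mem_adjoin_singleton R θ
  choose r hr0 hr using hmul
  -- A common denominator: every y in Y lies in R[θ][1/e]. The factor d keeps d out of M as well.
  set e : R := d * ∏ y ∈ Y, r y with he
  have he0 : e ≠ 0 := mul_ne_zero hd (Finset.prod_ne_zero_iff.2 fun y _ ↦ hr0 y)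
  obtain ⟨M, a, hM, ha, heM⟩ := Polynomial.exists_isMaximal_eval_mem_notMem (f := minpoly R θ)
    (minpoly.natDegree_pos hint).ne' he0
  -- As R is integrally closed, R[θ] is R[X] modulo the minimal polynomial of θ, so θ may be sent to
  -- the root a modulo M. Since e is not in M, the map extends to the localization, whose image in L
  -- is the required subalgebra.
  let ψ : C →ₐ[R] R ⧸ M := (AdjoinRoot.liftAlgHom (minpoly R θ) (Algebra.ofId R (R ⧸ M))
    (Ideal.Quotient.mk M a) (by
      change (minpoly R θ).eval₂ (Ideal.Quotient.mk M) (Ideal.Quotient.mk M a) = 0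
      rw [eval₂_hom]
      exact Ideal.Quotient.eq_zero_iff_mem.2 ha)).comp (minpoly.equivAdjoin hint).symm.toAlgHom
  let N : Submonoid C := Submonoid.powers (algebraMap R C e)
  have hψ (z : N) : IsUnit (ψ z) := by
    obtain ⟨_, n, rfl⟩ := z
    have hne : Ideal.Quotient.mk M e ≠ 0 := fun h ↦ heM (Ideal.Quotient.eq_zero_iff_mem.1 h)
    let := Ideal.Quotient.field M
    rw [map_pow, AlgHom.commutes]
    exact IsUnit.pow n (isUnit_iff_ne_zero.2 hne)
  have heL : algebraMap R L e ≠ 0 := fun h ↦ he0 (hRL (h.trans (map_zero _).symm))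
  have hval (z : N) : IsUnit (C.val z) := by
    obtain ⟨_, n, rfl⟩ := z
    rw [map_pow, AlgHom.commutes]
    exact IsUnit.pow n (IsUnit.mk0 _ heL)
  let ι : Localization N →ₐ[R] L := IsLocalization.liftAlgHom (M := N) hval
  have hι (c : C) : ι (algebraMap C _ c) = c := IsLocalization.lift_eq _ c
  have hinj : Function.Injective ι := by
    refine (IsLocalization.lift_injective_iff (M := N) (S := Localization N) _).2 fun x y ↦ ?_
    have hN : N ≤ nonZeroDivisors C := by
      refine powers_le_nonZeroDivisors_of_noZeroDivisors fun h ↦ heL ?_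
      exact congrArg (algebraMap C L) h
    exact ((IsLocalization.injective (Localization N) hN).eq_iff (a := x) (b := y)).trans
      (Subtype.val_injective.eq_iff (a := x) (b := y)).symm
  refine ⟨M, ι.range, hM, fun h ↦ heM (M.mul_mem_right _ h), fun y hy ↦ ?_,
    ⟨(IsLocalization.liftAlgHom (M := N) (S := Localization N) hψ).comp
      (AlgEquiv.ofInjective ι hinj).symm.toAlgHom⟩⟩
  have hdvd : r y ∣ e := (Finset.dvd_prod_of_mem r hy).trans (dvd_mul_left _ _)
  obtain ⟨s, hs⟩ := hdvd
  have hmem : algebraMap R L e * y ∈ C := by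
    rw [hs, mul_comm (r y), map_mul, mul_assoc]
    exact C.mul_mem (C.algebraMap_mem s) (hr y)
  refine ⟨IsLocalization.mk' _ ⟨_, hmem⟩ (⟨_, 1, pow_one _⟩ : N), ?_⟩
  have h1 := congrArg ι (IsLocalization.mk'_spec (Localization N) (⟨_, hmem⟩ : C)
    (⟨_, 1, pow_one _⟩ : N))
  rw [map_mul, hι, hι] at h1
  have h2 : ((algebraMap R C e : C) : L) = algebraMap R L e := rfl
  simp only [h2] at h1
  rw [mul_comm] at h1
  exact mul_left_cancel₀ heL h1

end ResidueFields

/-! ### A prime modulo which given elements are kth powers. -/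

section PowerResidues

open Polynomial

universe u

/-- As n is nonzero in K, X ^ n - c is separable for c ≠ 0, so its roots lie in the separable
closure. -/
theorem exists_finite_separable_forall_mem_exists_pow_eq {K : Type u} [Field K] (C : Finset K)
    (n : ℕ) [NeZero (n : K)] :
    ∃ (L : Type u) (_ : Field L) (_ : Algebra K L), FiniteDimensional K L ∧
      Algebra.IsSeparable K L ∧ ∀ c ∈ C, ∃ x : L, x ^ n = algebraMap K L c := by
  have (c : K) : ∃ x : SeparableClosure K, x ^ n = algebraMap K _ c := by
    have : NeZero (n : SeparableClosure K) := ⟨fun h ↦ NeZero.ne (n : K) <|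
      (algebraMap K (SeparableClosure K)).injective (by rw [map_natCast, h, map_zero])⟩
    exact IsSepClosed.exists_pow_nat_eq _ n
  choose x hx using this
  refine ⟨IntermediateField.adjoin K (x '' C), inferInstance, inferInstance, ?_, ?_, fun c hc ↦
    ⟨⟨x c, IntermediateField.subset_adjoin _ _ ⟨c, hc, rfl⟩⟩, Subtype.ext (hx c)⟩⟩
  · have : Finite (x '' C) := (C.finite_toSet.image x).to_subtype
    exact IntermediateField.finiteDimensional_adjoin
      fun y _ ↦ (Algebra.IsSeparable.isSeparable K y).isIntegral
  · infer_instance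

/-- This isolates the part of k whose roots can be adjoined separably; the factor q ^ e is treated
in the residue field. -/
theorem ExpChar.exists_eq_pow_mul (K : Type*) [Field K] (q : ℕ) [ExpChar K q] {k : ℕ}
    (hk : k ≠ 0) : ∃ e n : ℕ, k = n * q ^ e ∧ (n : K) ≠ 0 := by
  obtain _ | hq := ‹ExpChar K q›
  · exact ⟨0, k, by simp, Nat.cast_ne_zero.2 hk⟩
  · obtain ⟨e, n, hn, rfl⟩ := Nat.exists_eq_pow_mul_and_not_dvd hk q hq.ne_one
    exact ⟨e, n, mul_comm _ _, fun h ↦ hn ((CharP.cast_eq_zero_iff K q n).1 h)⟩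

/-- Frobenius is bijective on a finite field. Here q belongs to R and not to κ: when R has
characteristic zero, q is 1 and there is nothing to extract. -/
theorem FiniteField.exists_expChar_pow_eq {R κ : Type*} [CommRing R] [IsDomain R] [Field κ] [Finite κ]
    (f : R →+* κ) (q : ℕ) [ExpChar R q] (e : ℕ) (x : κ) : ∃ z, z ^ q ^ e = x := by
  obtain _ | hq := ‹ExpChar R q›
  · exact ⟨x, by simp⟩
  · have : CharP κ q := .of_ringHom_of_ne_zero f q hq.ne_zero
    have : ExpChar κ q := .prime hq
    have := PerfectRing.ofFiniteOfIsReduced q κ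
    obtain ⟨z, hz⟩ := (iterateFrobeniusEquiv κ q e).surjective x
    exact ⟨z, by rw [← hz, iterateFrobeniusEquiv_apply, iterateFrobenius_def]⟩

theorem exists_isPrime_isPowerResidue_notMem (R G : Type*) {K : Type*} [CommRing R]
    [IsDedekindDomain R] [Infinite R] [Finite Rˣ] [Field G] [Algebra R G]
    [IsFractionRing R G] [Field K] [Algebra R K] [Algebra G K] [IsScalarTower R G K]
    [FiniteDimensional G K] [Algebra.IsSeparable G K]
    (hfinq : ∀ M : Ideal R, M.IsMaximal → Finite (R ⧸ M)) {A : Subring K}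
    (hint : ∀ x, IsIntegral R x → x ∈ A) {N : R} (hN0 : N ≠ 0)
    (hN : ∀ a ∈ A, ∃ n : ℕ, IsIntegral R (algebraMap R K N ^ n * a))
    {k : ℕ} (hk : k ≠ 0) (C D : Finset A) (hD : 0 ∉ D) :
    ∃ P : Ideal A, P.IsPrime ∧ P ≠ ⊥ ∧ (∀ c ∈ C, IsPowerResidue k P c) ∧ ∀ a ∈ D, a ∉ P := by
  classical
  have hRK : Function.Injective (algebraMap R K) := by
    rw [IsScalarTower.algebraMap_eq R G K]
    exact (algebraMap G K).injective.comp (IsFractionRing.injective R G)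
  have hRA (r : R) : algebraMap R K r ∈ A := hint _ isIntegral_algebraMap
  let ρ : R →+* A := (algebraMap R K).codRestrict A hRA
  obtain ⟨q, hq⟩ := ExpChar.exists K
  have : ExpChar R q := (algebraMap R K).expChar hRK q
  obtain ⟨e, n, rfl, hn⟩ := ExpChar.exists_eq_pow_mul K q hk
  have : NeZero (n : K) := ⟨hn⟩
  obtain ⟨L, _, _, _, _, hL⟩ :=
    exists_finite_separable_forall_mem_exists_pow_eq (C.image Subtype.val) n
  let : Algebra G L := ((algebraMap K L).comp (algebraMap G K)).toAlgebra
  have : IsScalarTower G K L := .of_algebraMap_eq fun _ ↦ rfl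
  let : Algebra R L := ((algebraMap K L).comp (algebraMap R K)).toAlgebra
  have : IsScalarTower R K L := .of_algebraMap_eq fun _ ↦ rfl
  have : IsScalarTower R G L := .of_algebraMap_eq fun r ↦ by
    rw [IsScalarTower.algebraMap_apply R K L, IsScalarTower.algebraMap_apply R G K,
      ← IsScalarTower.algebraMap_apply G K L]
  have : FiniteDimensional G L := .trans G K L
  have : Algebra.IsSeparable G L := .trans G K L
  -- Each nonzero a divides in A a nonzero element r of R, because a⁻¹ has an integral multiple. To
  -- keep a out of P it therefore suffices to keep r out of M.
  have hdvd (a : A) : ∃ r : R, a ≠ 0 → r ≠ 0 ∧ a ∣ ρ r := by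
    by_cases ha : a = 0
    · exact ⟨0, fun h ↦ absurd ha h⟩
    · obtain ⟨y, hy, hya⟩ := exists_integral_multiples R G ({(a : K)⁻¹} : Finset K)
      refine ⟨y, fun _ ↦ ⟨hy, ⟨_, hint _ (hya _ (Finset.mem_singleton_self _))⟩, Subtype.ext ?_⟩⟩
      have ha' : (a : K) ≠ 0 := fun h ↦ ha (Subtype.ext h)
      change algebraMap R K y = a * (y • (a : K)⁻¹)
      rw [Algebra.smul_def, mul_left_comm, mul_inv_cancel₀ ha', mul_one]
  choose r hr using hdvd
  have : Module.Finite R (integralClosure R K) := IsIntegralClosure.finite R G K _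
  obtain ⟨Y, hY⟩ := (Module.Finite.iff_fg (R := R) (N := (integralClosure R K).toSubmodule)).1 this
  choose! x hx using hL
  -- B is made to contain module generators of the integral closure of R in K and the inverse of N,
  -- hence the image of A, and also the nth roots.
  obtain ⟨M, B, hM, hdM, hYB, ⟨φ⟩⟩ := exists_isMaximal_subalgebra_algHom (R := R) (G := G)
    (Y.image (algebraMap K L) ∪ {(algebraMap R L N)⁻¹} ∪ (C.image Subtype.val).image x)
    (d := ∏ a ∈ D, r a) (Finset.prod_ne_zero_iff.2 fun a ha ↦
      (hr a (fun h ↦ hD (h ▸ ha))).1)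
  have hintB (y : K) (hy : IsIntegral R y) : algebraMap K L y ∈ B := by
    have hle : (integralClosure R K).toSubmodule ≤
        B.toSubmodule.comap (IsScalarTower.toAlgHom R K L).toLinearMap := by
      rw [← hY, Submodule.span_le]
      intro y hy
      exact hYB (by simp [Finset.mem_coe.1 hy])
    exact hle hy
  have hAB (a : A) : algebraMap K L a ∈ B := by
    obtain ⟨m, hm⟩ := hN a a.2
    have hNB : (algebraMap R L N)⁻¹ ∈ B := hYB (by simp)
    have h0 : algebraMap R L N ≠ 0 := fun h ↦ hN0 <| hRK <| (algebraMap K L).injective <| by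
      rw [map_zero, map_zero, ← h]; rfl
    have : algebraMap K L a =
        (algebraMap R L N)⁻¹ ^ m * algebraMap K L (algebraMap R K N ^ m * a) := by
      rw [map_mul, map_pow, ← IsScalarTower.algebraMap_apply R K L, ← mul_assoc, ← mul_pow,
        inv_mul_cancel₀ h0, one_pow, one_mul]
    rw [this]
    exact B.mul_mem (B.pow_mem hNB m) (hintB _ hm)
  have := hfinq M hM
  let := Ideal.Quotient.field M
  let α : A →+* R ⧸ M := (φ : B →+* R ⧸ M).comp
    (((algebraMap K L).comp A.subtype).codRestrict B hAB)
  have hα (s : R) : α (ρ s) = Ideal.Quotient.mk M s := φ.commutes s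
  -- An infinite ring with finitely many units is not a field.
  have hM0 : M ≠ ⊥ := by
    refine Ring.ne_bot_of_isMaximal_of_not_isField hM fun hfield ↦ ?_
    let := hfield.toField
    have : Finite R := Finite.of_equiv _
      (unitsEquivNeZero.optionCongr.trans (Equiv.optionSubtypeNe (0 : R)))
    exact not_finite R
  obtain ⟨s, hsM, hs0⟩ := Submodule.exists_mem_ne_zero_of_ne_bot hM0
  refine ⟨RingHom.ker α, RingHom.ker_isPrime α, ?_, fun c hc ↦ ?_, fun a ha hmem ↦ hdM ?_⟩
  · refine (Submodule.ne_bot_iff _).2 ⟨ρ s, ?_, fun h ↦ hs0 (hRK ?_)⟩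
    · rw [RingHom.mem_ker, hα]
      exact Ideal.Quotient.eq_zero_iff_mem.2 hsM
    · rw [map_zero]
      exact congrArg Subtype.val h
  · have hxB : x c ∈ B := hYB (by simpa using .inr (.inr ⟨c, ⟨c.2, hc⟩, rfl⟩))
    -- A q^e-th root of the image of the nth root of c is a kth root of the image of c. It lifts to
    -- R, since the target is R/M.
    obtain ⟨z, hz⟩ := FiniteField.exists_expChar_pow_eq (Ideal.Quotient.mk M) q e (φ ⟨x c, hxB⟩)
    obtain ⟨z, rfl⟩ := Ideal.Quotient.mk_surjective z
    refine ⟨ρ z, Ideal.Quotient.eq.2 ?_⟩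
    rw [RingHom.mem_ker, map_sub, map_pow, hα, sub_eq_zero, mul_comm n, pow_mul, hz, ← map_pow]
    refine congrArg φ (Subtype.ext ?_)
    exact (hx c (Finset.mem_image_of_mem _ hc)).symm
  · have h1 : α (ρ (r a)) = 0 := by
      obtain ⟨b, hb⟩ := (hr a (fun h ↦ hD (h ▸ ha))).2
      rw [hb, map_mul, (RingHom.mem_ker).1 hmem, zero_mul]
    rw [hα, Ideal.Quotient.eq_zero_iff_mem] at h1
    exact M.mem_of_dvd (Finset.dvd_prod_of_mem r ha) h1

end PowerResidues

/-! ### From one prime to infinitely many. -/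

section PermutationChains

theorem infinite_setOf_isPermutationChain (R G : Type*) {K : Type*} [CommRing R]
    [IsDedekindDomain R] [Infinite R] [Finite Rˣ] [Field G] [Algebra R G]
    [IsFractionRing R G] [Field K] [Algebra R K] [Algebra G K] [IsScalarTower R G K]
    [FiniteDimensional G K] [Algebra.IsSeparable G K]
    (hfinq : ∀ M : Ideal R, M.IsMaximal → Finite (R ⧸ M))
    {S : Set (GlobalPrime K)} (hS : S.Finite)
    (hint : ∀ x : K, IsIntegral R x → x ∈ sIntegers S) {k m : ℕ} (hk : k ≠ 0)
    (r : Fin m → sIntegers S)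
    (hr : ∀ σ : Equiv.Perm (Fin m),
      Set.InjOn (fun p : Fin m × Fin m => consecutiveSum (fun l => r (σ l)) p.1 p.2)
        {p | p.1 ≤ p.2}) :
    {P : Ideal (sIntegers S) | P.IsPrime ∧ P ≠ ⊥ ∧ IsPermutationChain k P r ∧
      ∀ (σ : Equiv.Perm (Fin m)) (i j : Fin m), i ≤ j →
        consecutiveSum (fun l => r (σ l)) i j ≠ 0 →
          consecutiveSum (fun l => r (σ l)) i j ∉ P}.Infinite := by
  classical
  obtain ⟨N, hN0, hN⟩ := exists_ne_zero_forall_mem_sIntegers_isIntegral R G hS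
  intro hfin
  have hex (P : Ideal (sIntegers S)) : ∃ a, P ≠ ⊥ → a ∈ P ∧ a ≠ 0 := by
    by_cases h : P = ⊥
    · exact ⟨0, fun h' ↦ absurd h h'⟩
    · obtain ⟨a, ha⟩ := Submodule.exists_mem_ne_zero_of_ne_bot h
      exact ⟨a, fun _ ↦ ha⟩
  choose a ha using hex
  let C : Finset (sIntegers S) := Finset.univ.image
    fun p : Equiv.Perm (Fin m) × Fin m × Fin m ↦ consecutiveSum (fun l ↦ r (p.1 l)) p.2.1 p.2.2
  have hC (σ : Equiv.Perm (Fin m)) (i j : Fin m) : consecutiveSum (fun l ↦ r (σ l)) i j ∈ C :=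
    Finset.mem_image_of_mem (fun p : Equiv.Perm (Fin m) × Fin m × Fin m ↦
      consecutiveSum (fun l ↦ r (p.1 l)) p.2.1 p.2.2) (Finset.mem_univ (σ, i, j))
  -- The last set contains a nonzero element of each nonzero ideal in the supposedly finite set, so
  -- a prime avoiding D is new. Only differences that already vanish in A are discarded, and by
  -- hypothesis none comes from two different intervals under one permutation.
  let D := (C ∪ (C ×ˢ C).image (fun p ↦ p.1 - p.2) ∪ hfin.toFinset.image a).erase 0
  obtain ⟨P, hP, hP0, hPC, hPD⟩ := exists_isPrime_isPowerResidue_notMem R G hfinq hint hN0 hN hk C D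
    (Finset.notMem_erase _ _)
  have hmem : P ∈ hfin.toFinset := by
    refine hfin.mem_toFinset.2 ⟨hP, hP0, fun σ ↦ ⟨fun i j _ ↦ hPC _ (hC σ i j), ?_⟩,
      fun σ i j _ h0 ↦ hPD _ (Finset.mem_erase.2 ⟨h0, ?_⟩)⟩
    · intro p hp p' hp' heq
      by_contra hne
      refine hPD _ (Finset.mem_erase.2 ⟨sub_ne_zero.2 fun h ↦ hne (hr σ hp hp' h), ?_⟩)
        (Ideal.Quotient.eq.1 heq)
      exact Finset.mem_union_left _ (Finset.mem_union_right _ (Finset.mem_image.2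
        ⟨(_, _), Finset.mem_product.2 ⟨hC σ p.1 p.2, hC σ p'.1 p'.2⟩, rfl⟩))
    · exact Finset.mem_union_left _ (Finset.mem_union_left _ (hC σ i j))
  exact hPD (a P) (Finset.mem_erase.2 ⟨(ha P hP0).2, Finset.mem_union_right _
    (Finset.mem_image_of_mem a hmem)⟩) (ha P hP0).1

theorem infinite_setOf_isPermutationChain_of_numberField {K : Type*} [Field K] [NumberField K]
    {S : Set (GlobalPrime K)} (hS : S.Finite) {k m : ℕ} (hk : k ≠ 0) (r : Fin m → sIntegers S)
    (hr : ∀ σ : Equiv.Perm (Fin m),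
      Set.InjOn (fun p : Fin m × Fin m => consecutiveSum (fun l => r (σ l)) p.1 p.2)
        {p | p.1 ≤ p.2}) :
    {P : Ideal (sIntegers S) | P.IsPrime ∧ P ≠ ⊥ ∧ IsPermutationChain k P r ∧
      ∀ (σ : Equiv.Perm (Fin m)) (i j : Fin m), i ≤ j →
        consecutiveSum (fun l => r (σ l)) i j ≠ 0 →
          consecutiveSum (fun l => r (σ l)) i j ∉ P}.Infinite := by
  have hfinq (M : Ideal ℤ) (hM : M.IsMaximal) : Finite (ℤ ⧸ M) :=
    Ring.HasFiniteQuotients.finiteQuotient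
      (Ring.ne_bot_of_isMaximal_of_not_isField hM Int.not_isField)
  exact infinite_setOf_isPermutationChain ℤ ℚ hfinq hS
    (fun x hx ↦ mem_sIntegers_iff.2 fun V _ ↦ V.1.mem_of_isIntegral (fun n ↦ by simp) hx) hk r hr

end PermutationChains

/-! ### Separating elements in a subring. -/

section SeparatingElements

open IntermediateField

variable {F K : Type*} [Field F] [Field K] [Algebra F K]

theorem Transcendental.isTranscendenceBasis_singleton (htr : Algebra.trdeg F K = 1) {x : K}
    (hx : Transcendental F x) : IsTranscendenceBasis F ((↑) : ({x} : Set K) → K) := by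
  have hind : AlgebraicIndependent F ((↑) : ({x} : Set K) → K) :=
    algebraicIndependent_unique_type_iff.2 hx
  exact hind.isTranscendenceBasis_of_trdeg_le_of_finite (by simp [htr])

theorem IntermediateField.finiteDimensional_adjoin_simple_of_trdeg_eq_one
    [Algebra.EssFiniteType F K] (htr : Algebra.trdeg F K = 1) {x : K} (hx : Transcendental F x) :
    FiniteDimensional F⟮x⟯ K := by
  have : Algebra.IsAlgebraic F⟮x⟯ K := by
    convert! (hx.isTranscendenceBasis_singleton htr).isAlgebraic_field <;> simp
  have : Algebra.EssFiniteType F⟮x⟯ K := .of_comp F _ _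
  exact Algebra.finite_of_essFiniteType_of_isAlgebraic

/-- A subring with fraction field `K` contains a separating element. -/
theorem exists_mem_transcendental_isSeparable_adjoin_simple [Algebra.EssFiniteType F K]
    [PerfectField F] (p : ℕ) [hp : Fact p.Prime] [CharP F p] (htr : Algebra.trdeg F K = 1)
    (A : Subring K) (hA : ∀ z : K, ∃ a ∈ A, ∃ b ∈ A, z = a / b) :
    ∃ s ∈ A, Transcendental F s ∧ Algebra.IsSeparable F⟮s⟯ K := by
  have hnotle (L : IntermediateField F K) (hL : L ≠ ⊤) : ∃ a ∈ A, a ∉ L := by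
    by_contra! h
    refine hL (eq_top_iff.2 fun z _ ↦ ?_)
    obtain ⟨a, ha, b, hb, rfl⟩ := hA z
    exact L.div_mem (h a ha) (h b hb)
  have hne : {s | s ∈ A ∧ Transcendental F s}.Nonempty := by
    obtain ⟨s, hsA, hs⟩ := hnotle (algebraicClosure F K) fun h ↦ by
      have : Algebra.IsAlgebraic F K := (algebraicClosure.eq_top_iff F K).1 h
      exact zero_ne_one (trdeg_eq_zero.symm.trans htr)
    exact ⟨s, hsA, fun h ↦ hs (mem_algebraicClosure_iff.2 h)⟩
  -- A transcendental element of A with least inseparable degree is shown to be separating.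
  -- Otherwise some n in A lies outside the separable closure of F(s).
  let d (s : K) := Field.finInsepDegree F⟮s⟯ K
  let s := d.argminOn _ hne
  obtain ⟨hsA, hs⟩ := d.argminOn_mem _ hne
  refine ⟨s, hsA, hs, ?_⟩
  rw [← separableClosure.eq_top_iff]
  by_contra hsep
  obtain ⟨n, hnA, hn⟩ := hnotle ((separableClosure F⟮s⟯ K).restrictScalars F) fun h ↦
    hsep (restrictScalars_injective F (h.trans (restrictScalars_top).symm))
  have hns : n ∉ ({s} : Set K) := fun h ↦
    hn (le_restrictScalars_separableClosure _ (subset_adjoin _ _ h))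
  have : ExpChar F p := .prime hp.out
  have : CharP K p := .of_ringHom_of_ne_zero (algebraMap F K) p hp.out.ne_zero
  -- Frobenius is bijective on the perfect field F, so pth powers preserve linear independence over
  -- F.
  have H (T : Finset K) (hT : LinearIndepOn F _root_.id (T : Set K)) :
      LinearIndepOn F (· ^ p) (T : Set K) := by
    apply hT.map_of_injective_injective (frobeniusEquiv F p).symm (frobenius K p).toAddMonoidHom
    · simp
    · simp
    · intro r x
      change frobenius K p _ = r • frobenius K p x
      rw [Algebra.smul_def, map_mul, frobenius_def, ← map_pow, frobeniusEquiv_symm_pow_p,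
        Algebra.smul_def]
  -- One of s and n is separable over the field generated by the other, s'. The separable closure of
  -- F(s') then contains both, hence strictly contains that of F(s), against minimality.
  obtain ⟨i, hi₁, hi₂⟩ := exists_isTranscendenceBasis_and_isSeparable_of_linearIndepOn_pow'
    p hp.out (a := id) H {s} n (hs.isTranscendenceBasis_singleton htr) hns
  rw [Set.image_id] at hi₂
  obtain ⟨s', hs'⟩ : ∃ s', insert n {s} \ {i} = ({s'} : Set K) := by
    have hcard := hi₁.cardinalMk_eq_trdeg
    rw [htr, Cardinal.eq_one_iff_unique] at hcard
    obtain ⟨h1, ⟨x⟩⟩ := hcard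
    exact ⟨x, Set.eq_singleton_iff_unique_mem.2 ⟨x.2, fun y hy ↦
      Subtype.ext_iff.1 (h1.elim ⟨y, hy⟩ x)⟩⟩
  have hs'mem : s' ∈ insert n {s} \ {i} := hs' ▸ Set.mem_singleton s'
  have hs'A : s' ∈ A := by
    obtain rfl | h := hs'mem.1
    · exact hnA
    · exact (Set.mem_singleton_iff.1 h) ▸ hsA
  have hs'tr : Transcendental F s' := hi₁.1.transcendental ⟨s', hs'mem⟩
  rw [hs'] at hi₂
  have hmem (x : K) (hx : x ∈ insert n ({s} : Set K)) :
      x ∈ (separableClosure F⟮s'⟯ K).restrictScalars F := by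
    obtain rfl | hne := eq_or_ne x i
    · exact hi₂
    · have : x ∈ insert n ({s} : Set K) \ {i} := ⟨hx, hne⟩
      rw [hs'] at this
      exact le_restrictScalars_separableClosure _ (subset_adjoin _ _ this)
  have hlt : (separableClosure F⟮s⟯ K).restrictScalars F <
      (separableClosure F⟮s'⟯ K).restrictScalars F := by
    refine SetLike.lt_iff_le_and_exists.mpr ⟨?_, n, hmem n (.inl rfl), hn⟩
    rw [separableClosure_le_separableClosure_iff, adjoin_le_iff]
    rintro x rfl
    exact hmem _ (.inr rfl)
  have : FiniteDimensional F⟮s⟯ K := finiteDimensional_adjoin_simple_of_trdeg_eq_one htr hs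
  have : Module.Finite ((separableClosure F⟮s⟯ K).restrictScalars F) K :=
    inferInstanceAs <| Module.Finite (separableClosure F⟮s⟯ K) K
  exact d.not_lt_argminOn _ (⟨hs'A, hs'tr⟩ : s' ∈ {s | s ∈ A ∧ Transcendental F s})
    (by apply finrank_lt_of_gt hlt)

end SeparatingElements

/-! ### Valuations at the zeros and poles of polynomials. -/

section PolynomialValuations

open Polynomial

variable {F K : Type*} [Field F] [Field K]

theorem Valuation.isTrivialOn_of_finite [Finite F] [Algebra F K] {Γ : Type*}
    [LinearOrderedCommGroupWithZero Γ] (v : Valuation K Γ) : v.IsTrivialOn F where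
  eq_one a ha := by
    have h1 : a ^ (Nat.card Fˣ) = 1 := by
      exact congrArg Units.val (pow_card_eq_one' (x := Units.mk0 a ha))
    have h2 : v (algebraMap F K a) ^ (Nat.card Fˣ) = 1 := by
      rw [← map_pow, ← map_pow, h1, map_one, map_one]
    exact (pow_eq_one_iff.1 h2).resolve_right Nat.card_pos.ne'

/-- A pole of z would be a pole of every nonzero polynomial value p(z), which excludes p(z) = 0.
This applies to y and to y⁻¹. -/
theorem Valuation.map_eq_one_of_isAlgebraic [Algebra F K] {Γ : Type*}
    [LinearOrderedCommGroupWithZero Γ] (v : Valuation K Γ) [v.IsTrivialOn F] {y : K} (hy0 : y ≠ 0)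
    (hy : IsAlgebraic F y) : v y = 1 := by
  have key : ∀ z : K, IsAlgebraic F z → v z ≤ 1 := by
    rintro z ⟨p, hp, hpz⟩
    by_contra! h
    have := valuation_aeval_eq_valuation_X_pow_natDegree_of_one_lt_valuation_X z h hp
    rw [hpz, map_zero] at this
    exact (pow_pos (zero_lt_one.trans h) _).ne this
  refine le_antisymm (key y hy) ?_
  have := key _ hy.inv
  rwa [map_inv₀, inv_le_one₀ ((Valuation.pos_iff v).2 hy0)] at this

variable [Algebra F[X] K] [Algebra F K] [IsScalarTower F F[X] K]

theorem Polynomial.aeval_algebraMap_X (p : F[X]) :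
    aeval (algebraMap F[X] K X) p = algebraMap F[X] K p := by
  rw [aeval_algebraMap_apply, aeval_X_left_apply]

theorem Polynomial.algebraMap_mem_valuationSubring [Finite F] (W : ValuationSubring K)
    (hX : algebraMap F[X] K X ∈ W) (p : F[X]) : algebraMap F[X] K p ∈ W := by
  have := W.valuation.isTrivialOn_of_finite (F := F)
  induction p using Polynomial.induction_on' with
  | add p q hp hq => rw [map_add]; exact W.add_mem _ _ hp hq
  | monomial n a =>
    rw [← C_mul_X_pow_eq_monomial, map_mul, map_pow]
    refine W.mul_mem _ _ ((W.valuation_le_one_iff _).1 ?_) (pow_mem hX n)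
    rw [← Polynomial.algebraMap_eq, ← IsScalarTower.algebraMap_apply]
    obtain rfl | ha := eq_or_ne a 0
    · simp
    · exact (Valuation.IsTrivialOn.eq_one a ha).le

variable {Γ : Type*} [LinearOrderedCommGroupWithZero Γ]

theorem Polynomial.valuation_algebraMap_le_pow (v : Valuation K Γ) [v.IsTrivialOn F]
    (hX : 1 < v (algebraMap F[X] K X)) {p : F[X]} {n : ℕ} (hp : p.natDegree ≤ n) :
    v (algebraMap F[X] K p) ≤ v (algebraMap F[X] K X) ^ n := by
  obtain rfl | h0 := eq_or_ne p 0
  · simp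
  · rw [← aeval_algebraMap_X,
      valuation_aeval_eq_valuation_X_pow_natDegree_of_one_lt_valuation_X _ hX h0]
    exact pow_le_pow_right₀ hX.le hp

/-- The pole orders of an integral element at the poles of `X` are bounded. -/
theorem exists_forall_valuation_le_pow_of_isIntegral [Finite F] {x : K}
    (hx : IsIntegral F[X] x) :
    ∃ M : ℕ, ∀ W : ValuationSubring K, 1 < W.valuation (algebraMap F[X] K X) →
      W.valuation x ≤ W.valuation (algebraMap F[X] K X) ^ M := by
  obtain ⟨f, hf, hfx⟩ := hx
  -- M bounds the degrees of the lower coefficients. If x had a larger pole, the leading term of its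
  -- monic equation would strictly dominate.
  refine ⟨(Finset.range f.natDegree).sup fun j ↦ (f.coeff j).natDegree, fun W hX ↦ ?_⟩
  set v := W.valuation
  have := v.isTrivialOn_of_finite (F := F)
  set M := (Finset.range f.natDegree).sup fun j ↦ (f.coeff j).natDegree
  by_contra! h
  have h1 : 1 < v x := (one_le_pow₀ hX.le).trans_lt h
  rw [eval₂_eq_sum_range, Finset.sum_range_succ, hf.coeff_natDegree, map_one, one_mul,
    add_eq_zero_iff_eq_neg] at hfx
  have hlt : v (∑ j ∈ Finset.range f.natDegree, algebraMap F[X] K (f.coeff j) * x ^ j) <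
      v x ^ f.natDegree := by
    refine v.map_sum_lt (pow_pos (zero_lt_one.trans h1) _).ne' fun j hj ↦ ?_
    rw [map_mul, map_pow]
    have hle : v (algebraMap F[X] K (f.coeff j)) ≤ v (algebraMap F[X] K X) ^ M :=
      valuation_algebraMap_le_pow v hX (Finset.le_sup (f := fun j ↦ (f.coeff j).natDegree) hj)
    calc v (algebraMap F[X] K (f.coeff j)) * v x ^ j
        < v x * v x ^ j :=
          mul_lt_mul_of_pos_right (hle.trans_lt h) (pow_pos (zero_lt_one.trans h1) _)
      _ = v x ^ (j + 1) := (pow_succ' _ _).symm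
      _ ≤ v x ^ f.natDegree := pow_le_pow_right₀ h1.le (Finset.mem_range.1 hj)
  rw [hfx, Valuation.map_neg, map_pow] at hlt
  exact hlt.false

end PolynomialValuations

/-! ### Counting residues in a free module. -/

section Pigeonhole

open Polynomial

/-- In a free `F[X]`-module, a combination of basis elements with coefficients of small degree and
of further elements, with constant coefficients, is divisible by `a` when there are enough of them. -/
theorem exists_degree_lt_sum_eq_smul {F O ι : Type*} [Field F] [Finite F] [AddCommGroup O]
    [Module F[X] O] [Fintype ι] (e : Module.Basis ι F[X] O) {a : F[X]} (ha : a ≠ 0)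
    {H h : ℕ} (β : Fin h → O) (hcard : Fintype.card ι * a.natDegree < Fintype.card ι * H + h) :
    ∃ (p : ι → F[X]) (c : Fin h → F) (o : O), (∀ i, (p i).degree < H) ∧ (p ≠ 0 ∨ c ≠ 0) ∧
      ∑ i, p i • e i + ∑ j, C (c j) • β j = a • o := by
  classical
  have := Fintype.ofFinite F
  let ξ : (ι → degreeLT F H) × (Fin h → F) → O := fun z ↦
    ∑ i, (z.1 i : F[X]) • e i + ∑ j, C (z.2 j) • β j
  have hmod (x : F[X]) : x % a ∈ degreeLT F a.natDegree := by
    rw [mem_degreeLT, ← degree_eq_natDegree ha]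
    exact EuclideanDomain.mod_lt x ha
  -- Record the coordinates modulo a. There are more coefficient vectors than residues, and the
  -- difference of two vectors with equal residues gives the relation.
  let φ : (ι → degreeLT F H) × (Fin h → F) → ι → degreeLT F a.natDegree :=
    fun z i ↦ ⟨e.repr (ξ z) i % a, hmod _⟩
  let E (n : ℕ) : degreeLT F n ≃ (Fin n → F) := (degreeLTEquiv F n).toEquiv
  have (n : ℕ) : Fintype (degreeLT F n) := Fintype.ofEquiv _ (E n).symm
  have hcardE (n : ℕ) : Fintype.card (degreeLT F n) = Fintype.card F ^ n := by
    rw [Fintype.card_congr (E n)]; simp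
  obtain ⟨z, w, hne, heq⟩ := Fintype.exists_ne_map_eq_of_card_lt φ (by
    simp only [Fintype.card_prod, Fintype.card_fun, hcardE, Fintype.card_fin, ← pow_mul, ← pow_add]
    refine Nat.pow_lt_pow_right Fintype.one_lt_card ?_
    rwa [mul_comm, mul_comm H])
  have hdvd (i : ι) : a ∣ e.repr (ξ z - ξ w) i := by
    have h1 : e.repr (ξ z) i % a = e.repr (ξ w) i % a := congrArg Subtype.val (congrFun heq i)
    rw [map_sub, Finsupp.sub_apply, ← EuclideanDomain.mod_eq_zero, sub_mod, h1, sub_self]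
  choose q hq using hdvd
  refine ⟨fun i ↦ z.1 i - w.1 i, fun j ↦ z.2 j - w.2 j, ∑ i, q i • e i, fun i ↦ ?_, ?_, ?_⟩
  · exact mem_degreeLT.1 ((degreeLT F H).sub_mem (z.1 i).2 (w.1 i).2)
  · by_contra! hzero
    refine hne (Prod.ext (funext fun i ↦ Subtype.ext ?_) (funext fun j ↦ ?_))
    · exact sub_eq_zero.1 (congrFun hzero.1 i)
    · exact sub_eq_zero.1 (congrFun hzero.2 j)
  · have h1 : ξ z - ξ w = a • ∑ i, q i • e i := by
      rw [← e.sum_repr (ξ z - ξ w), Finset.smul_sum]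
      exact Finset.sum_congr rfl fun i _ ↦ by rw [hq, mul_smul]
    rw [← h1]
    simp only [ξ, sub_smul, map_sub, Finset.sum_sub_distrib]
    abel

end Pigeonhole

/-! ### Functions with a single pole. -/

section Poles

open Polynomial

/-- In a function field over a finite field there is a nonconstant function whose only pole is a
given place. -/
theorem exists_transcendental_forall_mem_of_ne {F K : Type*} (G : Type*) [Field F] [Finite F]
    [Field K] [Algebra F[X] K] [Algebra F K] [IsScalarTower F F[X] K] [Field G] [Algebra F[X] G]
    [IsFractionRing F[X] G] [Algebra G K] [IsScalarTower F[X] G K] [FiniteDimensional G K]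
    [Algebra.IsSeparable G K] (V : ValuationSubring K) [IsDiscreteValuationRing V]
    (hXV : algebraMap F[X] K X ∈ V) :
    ∃ s : K, Transcendental F s ∧
      ∀ W : ValuationSubring K, IsDiscreteValuationRing W → W ≠ V → s ∈ W := by
  classical
  let O := integralClosure F[X] K
  have : IsDedekindDomain O := integralClosure.isDedekindDomain F[X] G K
  have : IsFractionRing O K := integralClosure.isFractionRing_of_finite_extension G K
  have hinj : Function.Injective (algebraMap F[X] K) := by
    rw [IsScalarTower.algebraMap_eq F[X] G K]
    exact (algebraMap G K).injective.comp (IsFractionRing.injective F[X] G)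
  have : FaithfulSMul F[X] K := (faithfulSMul_iff_algebraMap_injective _ _).2 hinj
  have : Module.Free F[X] O := IsIntegralClosure.module_free F[X] G K O
  have : Module.Finite F[X] O := IsIntegralClosure.finite F[X] G K O
  have htriv (W : ValuationSubring K) : W.valuation.IsTrivialOn F :=
    W.valuation.isTrivialOn_of_finite
  have hOW (W : ValuationSubring K) (hW : algebraMap F[X] K X ∈ W) (x : O) : (x : K) ∈ W :=
    W.mem_of_isIntegral (algebraMap_mem_valuationSubring W hW) x.2
  have hmemO {x : K} (hx : ∀ W : ValuationSubring K, IsDiscreteValuationRing W →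
      algebraMap F[X] K X ∈ W → x ∈ W) : IsIntegral F[X] x := by
    obtain ⟨y, hy⟩ := IsDedekindDomain.mem_range_algebraMap_of_forall_isDiscreteValuationRing
      (O := O) (x := x) fun W hW hOW ↦ hx W hW (hOW (algebraMap F[X] O X))
    exact hy ▸ y.2
  obtain ⟨b, hbV, hb⟩ := IsDedekindDomain.exists_notMem_forall_mem_of_ne (O := O) V (hOW V hXV)
  replace hb (W : ValuationSubring K) (hW : IsDiscreteValuationRing W)
    (hXW : algebraMap F[X] K X ∈ W) (hWV : W ≠ V) : b ∈ W := hb W hW (hOW W hXW) hWV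
  have hb1 : 1 < V.valuation b := by rwa [← not_le, V.valuation_le_one_iff]
  -- a polynomial that vanishes at `V` to an order that cancels the pole of `b`
  obtain ⟨u, hu0, huV, hub⟩ : ∃ u : F[X], u ≠ 0 ∧ V.valuation (algebraMap F[X] K u) < 1 ∧
      algebraMap F[X] K u * b ∈ V := by
    obtain ⟨r, hr0, hr⟩ := V.exists_ne_zero_valuation_lt_one F[X] G
      (algebraMap_mem_valuationSubring V hXV)
    obtain ⟨n₀, hn₀⟩ := V.exists_pow_mul_mem hr b
    refine ⟨r ^ (n₀ + 1), pow_ne_zero _ hr0, ?_, ?_⟩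
    · rw [map_pow, map_pow]
      exact pow_lt_one₀ zero_le hr n₀.succ_ne_zero
    · rw [map_pow]
      exact hn₀ _ n₀.le_succ
  have hudeg : 1 ≤ u.natDegree := by
    rw [Nat.one_le_iff_ne_zero]
    intro h
    rw [eq_C_of_natDegree_eq_zero h] at huV hu0
    refine huV.ne ?_
    rw [← Polynomial.algebraMap_eq, ← IsScalarTower.algebraMap_apply]
    exact Valuation.IsTrivialOn.eq_one _ fun h0 ↦ hu0 (by rw [h0, C_0])
  -- A nonconstant polynomial that is a unit at V. It serves at the end to exclude constants.
  let g : F[X] := X * u + 1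
  have hgdeg : g.natDegree = u.natDegree + 1 := by
    rw [natDegree_add_eq_left_of_natDegree_lt, natDegree_X_mul hu0]
    simp [natDegree_X_mul hu0]
  have hg0 : g ≠ 0 := fun h ↦ by simp [h] at hgdeg
  have hgV : V.valuation (algebraMap F[X] K g) = 1 := by
    rw [map_add, map_one, Valuation.map_add_eq_of_lt_right, map_one]
    rw [map_one, map_mul, map_mul]
    exact (mul_le_of_le_one_left' ((V.valuation_le_one_iff _).2 hXV)).trans_lt huV
  have hginv : ¬ IsIntegral F[X] (algebraMap F[X] K g)⁻¹ := by
    intro hint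
    rw [IsScalarTower.algebraMap_apply F[X] G K, ← map_inv₀,
      isIntegral_algebraMap_iff (algebraMap G K).injective,
      IsIntegrallyClosed.isIntegral_iff] at hint
    obtain ⟨y, hy⟩ := hint
    have hg0' : algebraMap F[X] G g ≠ 0 := by simpa using hg0
    have : g * y = 1 := IsFractionRing.injective F[X] G (by
      rw [map_mul, hy, mul_inv_cancel₀ hg0', map_one])
    have := natDegree_eq_zero_of_isUnit (IsUnit.of_mul_eq_one _ this)
    omega
  let ι := Module.Free.ChooseBasisIndex F[X] O
  let e : Module.Basis ι F[X] O := Module.Free.chooseBasis F[X] O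
  choose M' hM' using fun i ↦ exists_forall_valuation_le_pow_of_isIntegral (e i).2
  let M := Finset.univ.sup M'
  have hM (i : ι) (W : ValuationSubring K) (hW : 1 < W.valuation (algebraMap F[X] K X)) :
      W.valuation (e i) ≤ W.valuation (algebraMap F[X] K X) ^ M :=
    (hM' i W hW).trans (pow_le_pow_right₀ hW.le (Finset.le_sup (Finset.mem_univ i)))
  let n := Fintype.card ι
  -- With H + M = h * deg u, the degree of a is H + M + deg g. The pigeonhole needs n * deg a < n *
  -- H + h, that is n * (M + deg g) < h; the additional M + 1 makes h ≥ M, so the subtraction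
  -- defining H is not truncated.
  let h := n * (M + g.natDegree) + M + 1
  let H := h * u.natDegree - M
  let a : F[X] := u ^ h * g
  have ha0 : a ≠ 0 := mul_ne_zero (pow_ne_zero _ hu0) hg0
  have hHM : H + M = h * u.natDegree := by
    have : h * 1 ≤ h * u.natDegree := Nat.mul_le_mul_left h hudeg
    omega
  have hdeg : a.natDegree = H + M + g.natDegree := by
    rw [natDegree_mul (pow_ne_zero _ hu0) hg0, natDegree_pow, hHM]
  have hβint (j : Fin h) : IsIntegral F[X] (algebraMap F[X] K a * b ^ (j + 1 : ℕ)) := by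
    refine hmemO fun W hW hXW ↦ ?_
    by_cases hWV : W = V
    · subst hWV
      have : algebraMap F[X] K a * b ^ (j + 1 : ℕ) = algebraMap F[X] K (u ^ (h - (j + 1)) * g) *
          (algebraMap F[X] K u * b) ^ (j + 1 : ℕ) := by
        have : a = u ^ (h - (j + 1)) * g * u ^ (j + 1 : ℕ) := by
          rw [mul_right_comm, ← pow_add, Nat.sub_add_cancel j.2]
        rw [this, map_mul _ (u ^ (h - (j + 1)) * g), map_pow, mul_pow, mul_assoc]
      rw [this]
      exact W.mul_mem _ _ (algebraMap_mem_valuationSubring W hXW _) (pow_mem hub _)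
    · exact W.mul_mem _ _ (algebraMap_mem_valuationSubring W hXW _) (pow_mem (hb W hW hXW hWV) _)
  obtain ⟨p, c, o, hp, hpc, heq⟩ := exists_degree_lt_sum_eq_smul e ha0 (H := H)
    (fun j : Fin h ↦ (⟨_, hβint j⟩ : O)) (by
      rw [hdeg]
      change n * (H + M + g.natDegree) < n * H + (n * (M + g.natDegree) + M + 1)
      rw [add_assoc, mul_add]
      omega)
  let x : K := ∑ i, algebraMap F[X] K (p i) * e i
  let z : K := o - ∑ j : Fin h, algebraMap F K (c j) * b ^ (j + 1 : ℕ)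
  have hu0' : algebraMap F[X] K u ≠ 0 := fun h0 ↦ hu0 (hinj (h0.trans (map_zero _).symm))
  have hg0' : algebraMap F[X] K g ≠ 0 := fun h0 ↦ hg0 (hinj (h0.trans (map_zero _).symm))
  have hxz : x = algebraMap F[X] K u ^ h * (algebraMap F[X] K g * z) := by
    have h1 := congrArg (algebraMap O K) heq
    have h2 (j : Fin h) : algebraMap F[X] K (C (c j)) = algebraMap F K (c j) :=
      (IsScalarTower.algebraMap_apply F F[X] K (c j)).symm
    simp only [map_add, map_sum, Algebra.smul_def, map_mul,
      ← IsScalarTower.algebraMap_apply F[X] O K, h2] at h1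
    change x + ∑ j : Fin h, algebraMap F K (c j) * (algebraMap F[X] K a * b ^ (j + 1 : ℕ)) =
      algebraMap F[X] K a * (o : K) at h1
    simp only [mul_left_comm _ (algebraMap F[X] K a), ← Finset.mul_sum] at h1
    rw [eq_sub_of_add_eq h1, ← mul_sub, map_mul, map_pow, mul_assoc]
  -- If x = 0 then p = 0, so c ≠ 0. But then o would equal a polynomial in b without constant term,
  -- which has a pole at V, whereas o is integral.
  have hx0 : x ≠ 0 := by
    intro hx
    have hp0 : p = 0 := by
      have : ∑ i, p i • e i = 0 := Subtype.val_injective (by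
        simp only [x] at hx
        simpa [Algebra.smul_def] using hx)
      exact funext (Fintype.linearIndependent_iff.1 e.linearIndependent p this)
    have hc0 : c ≠ 0 := hpc.resolve_left (absurd hp0)
    obtain ⟨j, hj⟩ := Function.ne_iff.1 hc0
    let q : F[X] := ∑ j : Fin h, monomial (j + 1 : ℕ) (c j)
    have hqj : q.coeff (j + 1) = c j := by
      simp only [q, finsetSum_coeff, coeff_monomial]
      rw [Finset.sum_eq_single j] <;> simp +contextual [Fin.val_inj]
    have hqj0 : q.coeff (j + 1) ≠ 0 := hqj ▸ hj
    have hz : z = 0 := by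
      rw [hxz, mul_eq_zero, mul_eq_zero] at hx
      exact (hx.resolve_left (pow_ne_zero _ hu0')).resolve_left hg0'
    have hqb : aeval b q = o := by
      rw [sub_eq_zero.1 hz]
      simp [q, aeval_monomial]
    have h1 := valuation_aeval_eq_valuation_X_pow_natDegree_of_one_lt_valuation_X b hb1
      (p := q) fun h0 ↦ hqj0 (by rw [h0, coeff_zero])
    rw [hqb] at h1
    have h2 : 1 < V.valuation b ^ q.natDegree :=
      one_lt_pow₀ hb1 fun h0 ↦ by
        have := le_natDegree_of_ne_zero hqj0
        omega
    exact (h1 ▸ h2).not_ge ((V.valuation_le_one_iff _).2 (hOW V hXV o))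
  have hzW (W : ValuationSubring K) (hW : IsDiscreteValuationRing W)
      (hXW : algebraMap F[X] K X ∈ W) (hWV : W ≠ V) : z ∈ W := by
    refine W.toSubring.sub_mem (hOW W hXW o) (W.toSubring.sum_mem fun j _ ↦ ?_)
    refine W.mul_mem _ _ ?_ (pow_mem (hb W hW hXW hWV) _)
    rw [IsScalarTower.algebraMap_apply F F[X] K]
    exact algebraMap_mem_valuationSubring W hXW _
  -- If g * z were algebraic over F, it would be a unit everywhere. Then g⁻¹ would have the
  -- valuation of z away from V, and g is a unit at V; so g⁻¹ would be integral over F[X], which is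
  -- impossible.
  refine ⟨algebraMap F[X] K g * z, fun halg ↦ hginv (hmemO fun W hW hXW ↦ ?_), fun W hW hWV ↦ ?_⟩
  · rw [← W.valuation_le_one_iff, map_inv₀]
    by_cases hWV : W = V
    · rw [hWV, hgV, inv_one]
    · have h1 := W.valuation.map_eq_one_of_isAlgebraic (F := F)
        (fun h0 ↦ hx0 (by rw [hxz, h0, mul_zero])) halg
      rw [map_mul] at h1
      rw [inv_eq_of_mul_eq_one_right h1, W.valuation_le_one_iff]
      exact hzW W hW hXW hWV
  · by_cases hXW : algebraMap F[X] K X ∈ W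
    · exact W.mul_mem _ _ (algebraMap_mem_valuationSubring W hXW g) (hzW W hW hXW hWV)
    · have hX1 : 1 < W.valuation (algebraMap F[X] K X) := by
        rwa [← not_le, W.valuation_le_one_iff]
      -- At a pole of X, the coefficients contribute at most X ^ H and the basis X ^ M. Together
      -- this is the pole of u ^ h, so g * z = x / u ^ h is regular.
      have hxle : W.valuation x ≤ W.valuation (algebraMap F[X] K X) ^ (h * u.natDegree) := by
        refine W.valuation.map_sum_le fun i _ ↦ ?_
        rw [map_mul, ← hHM, pow_add]
        exact mul_le_mul' (valuation_algebraMap_le_pow _ hX1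
          (natDegree_le_of_degree_le (hp i).le)) (hM i W hX1)
      have hu1 : W.valuation (algebraMap F[X] K u) ^ h =
          W.valuation (algebraMap F[X] K X) ^ (h * u.natDegree) := by
        rw [← aeval_algebraMap_X u,
          valuation_aeval_eq_valuation_X_pow_natDegree_of_one_lt_valuation_X _ hX1 hu0,
          ← pow_mul, mul_comm]
      rw [hxz, map_mul, map_pow, ← hu1] at hxle
      rw [← W.valuation_le_one_iff]
      refine le_of_mul_le_mul_left (hxle.trans_eq (mul_one _).symm) (pow_pos ?_ _)
      exact (Valuation.pos_iff _).2 hu0'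

end Poles

/-! ### Separating S-integers and the function field case. -/

section FunctionFields

open Polynomial IntermediateField

variable (F : Type*) {K : Type*} [Field F] [Field K] [Algebra F K]

/-- The `F[X]`-algebra in which `X` acts as multiplication by `x`. -/
noncomputable abbrev Polynomial.aevalAlgebra {A : Type*} [CommRing A] [Algebra F A] (x : A) :
    Algebra F[X] A :=
  (aeval x).toRingHom.toAlgebra

variable {F}

theorem Polynomial.isScalarTower_aevalAlgebra {A : Type*} [CommRing A] [Algebra F A] (x : A) :
    letI := aevalAlgebra F x
    IsScalarTower F F[X] A :=
  letI := aevalAlgebra F x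
  .of_algebraMap_eq fun r ↦ ((aeval x).commutes r).symm

theorem IntermediateField.isScalarTower_adjoin_simple (s : K) :
    letI := aevalAlgebra F s
    letI := aevalAlgebra F (AdjoinSimple.gen F s)
    IsScalarTower F[X] F⟮s⟯ K :=
  letI := aevalAlgebra F s
  letI := aevalAlgebra F (AdjoinSimple.gen F s)
  .of_algebraMap_eq fun p ↦
    (aeval_algebraMap_apply K (AdjoinSimple.gen F s) p : aeval s p = _)

theorem Transcendental.isFractionRing_adjoin_simple {s : K} (hs : Transcendental F s) :
    letI := aevalAlgebra F (AdjoinSimple.gen F s)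
    IsFractionRing F[X] F⟮s⟯ := by
  let := aevalAlgebra F s
  let := aevalAlgebra F (AdjoinSimple.gen F s)
  have := isScalarTower_adjoin_simple (F := F) s
  have hinj : Function.Injective (algebraMap F[X] K) := transcendental_iff_injective.1 hs
  have hinj' : Function.Injective (algebraMap F[X] F⟮s⟯) := by
    rw [IsScalarTower.algebraMap_eq F[X] F⟮s⟯ K, RingHom.coe_comp] at hinj
    exact hinj.of_comp
  have : FaithfulSMul F[X] F⟮s⟯ := (faithfulSMul_iff_algebraMap_injective _ _).2 hinj'
  refine IsFractionRing.of_field _ _ fun z ↦ ?_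
  obtain ⟨p, q, hpq⟩ := (mem_adjoin_simple_iff F (z : K)).1 z.2
  refine ⟨p, q, Subtype.ext ?_⟩
  rw [hpq]
  change _ = algebraMap F⟮s⟯ K (algebraMap F[X] F⟮s⟯ p / algebraMap F[X] F⟮s⟯ q)
  rw [map_div₀, ← IsScalarTower.algebraMap_apply, ← IsScalarTower.algebraMap_apply]
  rfl

variable [Finite F]

theorem mem_sIntegers_of_isIntegral_aevalAlgebra {S : Set (GlobalPrime K)} {s : K}
    (hsS : s ∈ sIntegers S) {x : K}
    (hx : letI := aevalAlgebra F s; IsIntegral F[X] x) : x ∈ sIntegers S := by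
  let := aevalAlgebra F s
  have := isScalarTower_aevalAlgebra (F := F) s
  refine mem_sIntegers_iff.2 fun V hV ↦ V.1.mem_of_isIntegral
    (algebraMap_mem_valuationSubring V.1 ?_) hx
  have hX : algebraMap F[X] K X = s := aeval_X s
  rw [hX]
  exact mem_sIntegers_iff.1 hsS V hV

variable [Algebra.EssFiniteType F K]

/-- K is finite over F(s), so z times some nonzero polynomial in s is integral over F[s]; both
product and polynomial are S-integers. -/
theorem exists_mem_sIntegers_eq_div (htr : Algebra.trdeg F K = 1) {S : Set (GlobalPrime K)} {s : K}
    (hsS : s ∈ sIntegers S) (hs : Transcendental F s) (z : K) :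
    ∃ a ∈ sIntegers S, ∃ b ∈ sIntegers S, z = a / b := by
  let := aevalAlgebra F s
  let := aevalAlgebra F (AdjoinSimple.gen F s)
  have := isScalarTower_adjoin_simple (F := F) s
  have := hs.isFractionRing_adjoin_simple
  have := finiteDimensional_adjoin_simple_of_trdeg_eq_one htr hs
  obtain ⟨y, hy0, hy⟩ := exists_integral_multiples F[X] F⟮s⟯ ({z} : Finset K)
  have hy' : algebraMap F[X] K y ≠ 0 := fun h ↦ hy0
    (transcendental_iff_injective.1 hs (h.trans (map_zero _).symm))
  refine ⟨y • z, mem_sIntegers_of_isIntegral_aevalAlgebra hsS (hy z (by simp)),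
    algebraMap F[X] K y, mem_sIntegers_of_isIntegral_aevalAlgebra hsS isIntegral_algebraMap, ?_⟩
  rw [Algebra.smul_def, mul_div_cancel_left₀ _ hy']

theorem exists_transcendental_mem_sIntegers (htr : Algebra.trdeg F K = 1)
    {S : Set (GlobalPrime K)} {V : FinitePrime K} (hV : Sum.inl V ∈ S) :
    ∃ s ∈ sIntegers S, Transcendental F s := by
  obtain ⟨p, hp, _⟩ := CharP.exists' F |>.resolve_left fun h ↦ not_finite F
  obtain ⟨t, htV, ht, hsep⟩ : ∃ t ∈ V.1, Transcendental F t ∧ Algebra.IsSeparable F⟮t⟯ K := by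
    obtain ⟨t, -, ht, hsep⟩ := exists_mem_transcendental_isSeparable_adjoin_simple p htr ⊤
      fun z ↦ ⟨z, trivial, 1, trivial, (div_one z).symm⟩
    -- V must not be a pole of the variable. Replacing t by its inverse arranges this without
    -- changing F(t).
    obtain h | h := V.1.mem_or_inv_mem t
    · exact ⟨t, h, ht, hsep⟩
    · have heq : F⟮t⁻¹⟯ = F⟮t⟯ := by
        apply le_antisymm <;> rw [adjoin_simple_le_iff]
        · exact F⟮t⟯.inv_mem (mem_adjoin_simple_self F t)
        · simpa using F⟮t⁻¹⟯.inv_mem (mem_adjoin_simple_self F t⁻¹)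
      refine ⟨t⁻¹, h, fun halg ↦ ht (by simpa using halg.inv), ?_⟩
      rwa [heq]
  let := aevalAlgebra F t
  have := isScalarTower_aevalAlgebra (F := F) t
  let := aevalAlgebra F (AdjoinSimple.gen F t)
  have := isScalarTower_adjoin_simple (F := F) t
  have := ht.isFractionRing_adjoin_simple
  have := finiteDimensional_adjoin_simple_of_trdeg_eq_one htr ht
  have := V.2
  have hX : algebraMap F[X] K X = t := aeval_X t
  obtain ⟨s, hs, hsW⟩ := exists_transcendental_forall_mem_of_ne F⟮t⟯ V.1 (hX ▸ htV)
  exact ⟨s, mem_sIntegers_iff.2 fun W hW ↦ hsW W.1 W.2 fun h ↦ hW (Subtype.ext h ▸ hV), hs⟩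

theorem infinite_setOf_isPermutationChain_of_trdeg_eq_one (F : Type*) {K : Type*} [Field F]
    [Finite F] [Field K] [Algebra F K] [Algebra.EssFiniteType F K] (htr : Algebra.trdeg F K = 1)
    {S : Set (GlobalPrime K)} (hS : S.Finite) {V : FinitePrime K} (hV : Sum.inl V ∈ S)
    {k m : ℕ} (hk : k ≠ 0) (r : Fin m → sIntegers S)
    (hr : ∀ σ : Equiv.Perm (Fin m),
      Set.InjOn (fun p : Fin m × Fin m => consecutiveSum (fun l => r (σ l)) p.1 p.2)
        {p | p.1 ≤ p.2}) :
    {P : Ideal (sIntegers S) | P.IsPrime ∧ P ≠ ⊥ ∧ IsPermutationChain k P r ∧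
      ∀ (σ : Equiv.Perm (Fin m)) (i j : Fin m), i ≤ j →
        consecutiveSum (fun l => r (σ l)) i j ≠ 0 →
          consecutiveSum (fun l => r (σ l)) i j ∉ P}.Infinite := by
  obtain ⟨p, hp, _⟩ := CharP.exists' F |>.resolve_left fun h ↦ not_finite F
  -- Two choices are needed: s₀ may be inseparable and only shows that K is the fraction field of A,
  -- which then provides a separating s in A.
  obtain ⟨s₀, hs₀S, hs₀⟩ := exists_transcendental_mem_sIntegers htr hV
  obtain ⟨s, hsS, hs, hsep⟩ := exists_mem_transcendental_isSeparable_adjoin_simple p htr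
    (sIntegers S) (exists_mem_sIntegers_eq_div htr hs₀S hs₀)
  let := aevalAlgebra F s
  let := aevalAlgebra F (AdjoinSimple.gen F s)
  have := isScalarTower_adjoin_simple (F := F) s
  have := hs.isFractionRing_adjoin_simple
  have := finiteDimensional_adjoin_simple_of_trdeg_eq_one htr hs
  have : Finite F[X]ˣ := by
    refine Finite.of_surjective (Units.map (C : F →+* F[X]).toMonoidHom) fun u ↦ ?_
    obtain ⟨c, hc, hcu⟩ := Polynomial.isUnit_iff.1 u.isUnit
    exact ⟨hc.unit, Units.ext hcu⟩
  have hfinq (M : Ideal F[X]) (hM : M.IsMaximal) : Finite (F[X] ⧸ M) := by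
    let := Ideal.Quotient.field M
    have : Module.Finite F (F[X] ⧸ M) := finite_of_finite_type_of_isJacobsonRing F _
    exact Module.finite_of_finite F
  exact infinite_setOf_isPermutationChain F[X] F⟮s⟯ hfinq hS
    (fun _ hx ↦ mem_sIntegers_of_isIntegral_aevalAlgebra hsS hx) hk r hr

theorem IsGlobalFunctionField.exists_trdeg_eq_one {K : Type*} [Field K]
    (hK : IsGlobalFunctionField K) :
    ∃ F : Subfield K, Finite F ∧ Algebra.EssFiniteType F K ∧ Algebra.trdeg F K = 1 := by
  obtain ⟨F, t, hF, ht, hfin⟩ := hK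
  refine ⟨F, hF, ?_, ?_⟩
  · have : Algebra.EssFiniteType F F⟮t⟯ := essFiniteType_iff.2
      (fg_adjoin_of_finite (Set.finite_singleton t))
    exact .comp F F⟮t⟯ K
  · have hind : AlgebraicIndependent F ((↑) : ({t} : Set K) → K) :=
      algebraicIndependent_unique_type_iff.2 ht
    have hbasis : IsTranscendenceBasis F ((↑) : ({t} : Set K) → K) := by
      have : Algebra.IsAlgebraic F⟮t⟯ K := Algebra.IsAlgebraic.of_finite _ _
      rw [hind.isTranscendenceBasis_iff_isAlgebraic, Subtype.range_coe]
      exact isAlgebraic_adjoin_iff_top.1 this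
    rw [← hbasis.cardinalMk_eq_trdeg]
    simp

end FunctionFields

theorem theorem1p2 {K : Type*} [Field K] (hK : IsGlobalField K)
    (S : Set (GlobalPrime K)) (hSfin : S.Finite) (hSne : S.Nonempty)
    (hSarch : ∀ w : NumberField.InfinitePlace K, Sum.inr w ∈ S)
    (k m : ℕ) (hk : 1 ≤ k) (hm : 1 ≤ m) (r : Fin m → sIntegers S)
    (hr : ∀ σ : Equiv.Perm (Fin m),
      Set.InjOn (fun p : Fin m × Fin m => consecutiveSum (fun l => r (σ l)) p.1 p.2)
        {p | p.1 ≤ p.2}) :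
    {P : Ideal (sIntegers S) | P.IsPrime ∧ P ≠ ⊥ ∧ IsPermutationChain k P r ∧
      ∀ (σ : Equiv.Perm (Fin m)) (i j : Fin m), i ≤ j →
        consecutiveSum (fun l => r (σ l)) i j ≠ 0 →
          consecutiveSum (fun l => r (σ l)) i j ∉ P}.Infinite := by
  obtain hK | hK := hK
  · exact infinite_setOf_isPermutationChain_of_numberField hSfin (Nat.one_le_iff_ne_zero.1 hk) r hr
  · obtain ⟨F, _, _, htr⟩ := hK.exists_trdeg_eq_one
    obtain ⟨V | w, hV⟩ := hSne
    · exact infinite_setOf_isPermutationChain_of_trdeg_eq_one F htr hSfin hV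
        (Nat.one_le_iff_ne_zero.1 hk) r hr
    -- An archimedean prime embeds the finite field F in ℂ, which is absurd.
    · have : CharZero F := (w.embedding.comp (algebraMap F K)).charZero
      exact (not_finite F).elim
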